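/- **Setting.** A server holds $N$ files of equal size. There are $\Lambda$ caches, and $L_\lambda\in\mathbb{N}$ users are connected to cache $\lambda$, with $K=\sum_\lambda L_\lambda\le N$. In an uncoded placement, every file is cut into equally many subfiles of equal size, and each subfile is stored, uncoded, in a certain set of caches. After the placement every user requests one file (demand vector $\mathbf d\in[N]^K$), and the server broadcasts a message from which, together with the content of its own cache, every user must recover its file without error. For a placement $\mathcal Z$, let $T^*(\mathcal Z,\mathbf d,\mathbf L)$ be the smallest number of broadcast bits divided by the number of bits of a file (the infimum over all subfile sizes and all encoders and decoders). The worst-case optimal delivery time of $\mathcal Z$ for $\mathbf L$ is $\max_{\mathbf d}T^*(\mathcal Z,\mathbf d,\mathbf L)$. Let $t\in\{0,1,\dots,\Lambda\}$ and let $\bar{\mathbf L}=(\bar L_1,\dots,\bar L_\Lambda)$ be positive integers (the estimated occupancy vector; neither $\bar{\mathbf L}=\mathbf L$ nor $\sum_\lambda\bar L_\lambda=K$ is required). Put $\dot{\bar L}_q=\prod_{i\in q}\bar L_i$ for $q\subseteq[\Lambda]$, and $e_t(\bar{\mathbf L})=\sum_{q\subseteq[\Lambda],|q|=t}\dot{\bar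 L}_q$. The placement $\mathcal Z^*_{\bar{\mathbf L}}$ designed for $\bar{\mathbf L}$ (with normalized sum cache size $t$) cuts every file into $e_t(\bar{\mathbf L})$ equal subfiles indexed by pairs $(\tau,m)$ with $\tau\subseteq[\Lambda]$, $|\tau|=t$, $1\le m\le\dot{\bar L}_\tau$, and stores subfile $(\tau,m)$ in exactly the caches of $\tau$. **Theorem.** If the true occupancy vector is $\mathbf L$, then the optimal delivery time $T^*(t,\bar{\mathbf L},\mathbf L)=\max_{\mathbf d}T^*(\mathcal Z^*_{\bar{\mathbf L}},\mathbf d,\mathbf L)$ is exactly $$T^*(t,\bar{\mathbf L},\mathbf L)=\max_{\sigma\in S_{\Lambda,\Lambda-t}}\ \sum_{\lambda=1}^{\Lambda-t}L_{\sigma(\lambda)}\sum_{\substack{q\subseteq[\Lambda]\setminus\{\sigma(1),\dots,\sigma(\lambda)\}\\|q|=t}}\frac{\dot{\bar L}_q}{e_t(\bar{\mathbf L})},$$ where $S_{\Lambda,\Lambda-t}$ is the set of $(\Lambda-t)$-permutations of $[\Lambda]$, that is, of injective maps $\sigma:[\Lambda-t]\to[\Lambda]$. Moreover, if $\sum_\lambda\bar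 L_\lambda\le N$, then $\mathcal Z^*_{\bar{\mathbf L}}$ is indeed optimal for $\bar{\mathbf L}$: it minimizes $\max_{\mathbf d}T^*(\mathcal Z,\mathbf d,\bar{\mathbf L})$ among all uncoded placements $\mathcal Z$ that store every subfile of the library in exactly $t$ caches (regular placements of normalized sum cache size $t$). -/

import Mathlib

namespace SharedCache

/-- The users of a network with `Λ` caches and occupancy vector `L`: the pair `⟨i, l⟩` is the
`l`-th user connected to cache `i`. There are `∑ i, L i` of them. -/
abbrev User {Λ : ℕ} (L : Fin Λ → ℕ) : Type := Σ i : Fin Λ, Fin (L i)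

/-- An uncoded cache placement for `Λ` caches and `N` files. Every file is cut into subfiles of
equal size, indexed by the finite nonempty type `Idx`, and `stored n j` is the set of exactly those
caches in which subfile `j` of file `n` is stored, as it is. -/
structure Placement (Λ N : ℕ) where
  Idx : Type
  fintypeIdx : Fintype Idx
  nonemptyIdx : Nonempty Idx
  stored : Fin N → Idx → Finset (Fin Λ)

attribute [instance] Placement.fintypeIdx Placement.nonemptyIdx

namespace Placement

variable {Λ N : ℕ}

/-- The realizations of the library when each subfile consists of `b` bits. -/
abbrev Library (Z : Placement Λ N) (b : ℕ) : Type := Fin N → Z.Idx → Fin b → Bool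

/-- The possible contents of cache `i`: the values of the subfiles stored in it. -/
abbrev CacheContent (Z : Placement Λ N) (b : ℕ) (i : Fin Λ) : Type :=
  (n : Fin N) → {j : Z.Idx // i ∈ Z.stored n j} → Fin b → Bool

/-- The content of cache `i` when the library is `W`. -/
def cache (Z : Placement Λ N) {b : ℕ} (i : Fin Λ) (W : Z.Library b) : Z.CacheContent b i :=
  fun n j => W n j.1

/-- With subfiles of `b` bits, the demands `d` can be delivered by broadcasting `m` bits: there is
an encoder such that every user recovers without error the file it asked for, from the broadcast
message and the content of its own cache. -/
def Deliverable (Z : Placement Λ N) (L : Fin Λ → ℕ) (d : User L → Fin N) (b m : ℕ) : Prop :=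
  ∃ enc : Z.Library b → (Fin m → Bool),
    ∀ u : User L, ∃ dec : (Fin m → Bool) → Z.CacheContent b u.1 → (Z.Idx → Fin b → Bool),
      ∀ W : Z.Library b, dec (enc W) (Z.cache u.1 W) = W (d u)

/-- The optimal delivery time for the placement `Z`, the demands `d` and the occupancy vector `L`:
the smallest number of broadcast bits, in units of the size of one file, over all subfile sizes and
all delivery schemes. -/
noncomputable def deliveryTime (Z : Placement Λ N) (L : Fin Λ → ℕ) (d : User L → Fin N) : ℝ :=
  sInf {T : ℝ | ∃ b m : ℕ, 0 < b ∧ Z.Deliverable L d b m ∧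
    T = (m : ℝ) / ((Fintype.card Z.Idx : ℝ) * (b : ℝ))}

/-- The worst-case (over the finitely many demand vectors) optimal delivery time of the
placement `Z` when the users are connected according to `L`. -/
noncomputable def worstCaseTime (Z : Placement Λ N) (L : Fin Λ → ℕ) : ℝ :=
  ⨆ d : User L → Fin N, Z.deliveryTime L d

/-- The placement is regular with normalized sum cache size `t`: every subfile of the library is
stored in exactly `t` caches. -/
def IsRegular (Z : Placement Λ N) (t : ℕ) : Prop :=
  ∀ n j, (Z.stored n j).card = t

/-- `Z` minimizes the worst-case delivery time for the occupancy vector `L` among the regular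
uncoded placements (and memory allocations) of normalized sum cache size `t`. -/
def IsOptimalRegular (Z : Placement Λ N) (t : ℕ) (L : Fin Λ → ℕ) : Prop :=
  Z.IsRegular t ∧ ∀ Z' : Placement Λ N, Z'.IsRegular t → Z.worstCaseTime L ≤ Z'.worstCaseTime L

end Placement

/-- The memory allocation and placement designed for the occupancy vector `L`: every file is cut
into `e_t(L)` subfiles `(τ, m)`, where `τ` is a set of `t` caches and `m` is one of
`∏ i ∈ τ, L i` values, and the subfile `(τ, m)` is stored in exactly the caches of `τ`. -/
def designedPlacement {Λ : ℕ} (N t : ℕ) (ht : t ≤ Λ) (L : Fin Λ → ℕ) (hL : ∀ i, 0 < L i) :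
    Placement Λ N where
  Idx := Σ τ : {τ : Finset (Fin Λ) // τ.card = t}, Fin (∏ i ∈ τ.1, L i)
  fintypeIdx := inferInstance
  nonemptyIdx := by
    obtain ⟨τ, -, hτ⟩ := Finset.exists_subset_card_eq
      (show t ≤ (Finset.univ : Finset (Fin Λ)).card by simpa using ht)
    exact ⟨⟨⟨τ, hτ⟩, ⟨0, Finset.prod_pos fun i _ => hL i⟩⟩⟩
  stored := fun _ j => j.1.1

/-- The elementary symmetric function `e_t(L)` of the entries of `L`. -/
def esymm {Λ : ℕ} (L : Fin Λ → ℕ) (t : ℕ) : ℕ :=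
  ((Finset.univ : Finset (Fin Λ)).val.map L).esymm t

/-- For a `(Λ - t)`-permutation `σ` of the caches, the sum over `k` of `L (σ k)` times the sum of
`(∏ i ∈ q, Lbar i) / e_t(Lbar)` over the `t`-subsets `q` of the caches that avoid `σ` up to and
including position `k`. -/
noncomputable def permutationValue {Λ : ℕ} (t : ℕ) (Lbar L : Fin Λ → ℕ)
    (σ : Fin (Λ - t) ↪ Fin Λ) : ℝ :=
  ∑ k : Fin (Λ - t), (L (σ k) : ℝ) *
    ∑ q ∈ Finset.powersetCard t (Finset.univ \ (Finset.Iic k).map σ),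
      ((∏ i ∈ q, Lbar i : ℕ) : ℝ) / (esymm Lbar t : ℝ)

end SharedCache

/-! Lower bound. Let the demands be distinct and order the caches. Keep free only the requested
subfiles whose caches all come after the cache of the requesting user, and set every other bit to
zero. In this order each cache holds only free bits of users at earlier caches, so the message alone
determines all free bits and has at least as many bits (`Deliverable.acyclicCount_mul_le`). For the
designed placement the count is the value of the permutation.

Upper bound. For each `(t+1)`-set `S` of caches, the users at `i ∈ S` need `L i * ∏ c ∈ S \ {i},
Lbar c` subfiles stored exactly in `S \ {i}`. Summing these lists over `i`, padded with zeros to the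
longest, serves all of `S`. The longest list belongs to the largest ratio `L i / Lbar i`, since its
length is that ratio times `∏ c ∈ S, Lbar c`. With the caches sorted by decreasing ratio, each `S`
is charged to its first cache, and the total length is at most the value of that permutation
(`exists_sum_multicastLength_le`).

Optimality. If `L = Lbar`, all lists for `S` have length `∏ c ∈ S, L c`, so the time is at most
`e_{t+1}(L) / e_t(L)`. For any regular placement, averaging the acyclic bound over cyclic shifts of
an injective demand removes the dependence on individual files, and a greedily chosen order
(`exists_order_le`) reaches the same ratio. -/

namespace SharedCache

/-! ### Delivery schemes and the acyclic index coding bound -/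

namespace Placement

variable {Λ N : ℕ}

/-- A message of finitely many bits from which, together with the cache content, the requested
file is determined, is a delivery scheme. -/
theorem deliverable_of_determines (Z : Placement Λ N) {L : Fin Λ → ℕ} {d : User L → Fin N}
    {b m : ℕ} {M : Type} [Fintype M] (hM : Fintype.card M = m) (enc : Z.Library b → M → Bool)
    (h : ∀ (u : User L) (W W' : Z.Library b), enc W = enc W' → Z.cache u.1 W = Z.cache u.1 W' →
      W (d u) = W' (d u)) :
    Z.Deliverable L d b m := by
  classical
  let e := Fintype.equivFinOfCardEq hM
  refine ⟨fun W k => enc W (e.symm k), fun u => ?_⟩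
  -- The decoder picks any library consistent with what it sees; the true one is consistent, so the
  -- default value is never used.
  refine ⟨fun x c => if hx : ∃ W : Z.Library b, (fun k => enc W (e.symm k)) = x ∧
    Z.cache u.1 W = c then hx.choose (d u) else fun _ _ => false, fun W => ?_⟩
  have hx : ∃ W' : Z.Library b, (fun k => enc W' (e.symm k)) = (fun k => enc W (e.symm k)) ∧
    Z.cache u.1 W' = Z.cache u.1 W := ⟨W, rfl, rfl⟩
  beta_reduce
  rw [dif_pos hx]
  refine h u _ _ ?_ hx.choose_spec.2
  funext k
  simpa using congrFun hx.choose_spec.1 (e k)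

/-- Broadcasting the whole library works, so the infimum defining the delivery time is over a
nonempty set. -/
theorem exists_deliverable (Z : Placement Λ N) (L : Fin Λ → ℕ) (d : User L → Fin N) :
    ∃ m, Z.Deliverable L d 1 m := by
  refine ⟨_, Z.deliverable_of_determines (M := Fin N × Z.Idx) rfl (fun W p => W p.1 p.2 0) ?_⟩
  intro u W W' h _
  funext j k
  rw [Subsingleton.elim k 0]
  exact congrFun h (d u, j)

theorem bddBelow_rates (Z : Placement Λ N) (L : Fin Λ → ℕ) (d : User L → Fin N) :
    BddBelow {T : ℝ | ∃ b m : ℕ, 0 < b ∧ Z.Deliverable L d b m ∧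
      T = (m : ℝ) / ((Fintype.card Z.Idx : ℝ) * (b : ℝ))} := by
  refine ⟨0, ?_⟩
  rintro _ ⟨b, m, -, -, rfl⟩
  positivity

theorem deliveryTime_le (Z : Placement Λ N) {L : Fin Λ → ℕ} {d : User L → Fin N} {m : ℕ}
    (h : Z.Deliverable L d 1 m) : Z.deliveryTime L d ≤ (m : ℝ) / Fintype.card Z.Idx :=
  csInf_le (Z.bddBelow_rates L d) ⟨1, m, one_pos, h, by simp⟩

theorem deliveryTime_le_worstCaseTime (Z : Placement Λ N) {L : Fin Λ → ℕ} (d : User L → Fin N) :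
    Z.deliveryTime L d ≤ Z.worstCaseTime L :=
  le_ciSup (Set.finite_range _).bddAbove d

/-- The number of pairs of a user `u` and a requested subfile of `u` all of whose caches come
strictly after the cache of `u` in the order given by `r`. -/
def acyclicCount (Z : Placement Λ N) (L : Fin Λ → ℕ) (d : User L → Fin N) (r : Fin Λ → ℕ) : ℕ :=
  ∑ u : User L, (Finset.univ.filter fun j : Z.Idx => ∀ c ∈ Z.stored (d u) j, r u.1 < r c).card

/-- The acyclic index coding bound. -/
theorem Deliverable.acyclicCount_mul_le {Z : Placement Λ N} {L : Fin Λ → ℕ} {d : User L → Fin N}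
    {b m : ℕ} (h : Z.Deliverable L d b m) (hd : Function.Injective d) (r : Fin Λ → ℕ) :
    Z.acyclicCount L d r * b ≤ m := by
  classical
  obtain ⟨enc, h⟩ := h
  choose dec hdec using h
  let P := Σ u : User L, {j : Z.Idx // ∀ c ∈ Z.stored (d u) j, r u.1 < r c}
  let y : (P → Fin b → Bool) → User L → Z.Idx → Fin b → Bool := fun x u j =>
    if hj : ∀ c ∈ Z.stored (d u) j, r u.1 < r c then x ⟨u, ⟨j, hj⟩⟩ else fun _ => false
  let W : (P → Fin b → Bool) → Z.Library b := fun x =>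
    Function.extend d (y x) fun _ _ _ => false
  have hinj : Function.Injective fun x => enc (W x) := by
    intro x x' hx
    -- Users decode in increasing order of `r`: a free bit stored in the cache of `u` belongs to a
    -- user at a strictly earlier cache, hence is already determined.
    have key : ∀ v : ℕ, ∀ u : User L, r u.1 = v → y x u = y x' u := by
      intro v
      induction v using Nat.strong_induction_on with
      | _ v ih =>
        intro u hu
        have hc : Z.cache u.1 (W x) = Z.cache u.1 (W x') := by
          funext n j
          change W x n j.1 = W x' n j.1
          by_cases hn : ∃ u', d u' = n
          · obtain ⟨u', rfl⟩ := hn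
            simp only [W, hd.extend_apply]
            by_cases hj : ∀ c ∈ Z.stored (d u') j.1, r u'.1 < r c
            · rw [ih (r u'.1) (hu ▸ hj _ j.2) u' rfl]
            · simp only [y, dif_neg hj]
          · simp only [W, Function.extend_apply' _ _ _ hn]
        have h1 := hdec u (W x)
        have h2 := hdec u (W x')
        have hx' : enc (W x) = enc (W x') := hx
        rw [hx', hc, h2] at h1
        simpa only [W, hd.extend_apply] using h1.symm
    funext ⟨u, j⟩
    have := congrFun (key _ u rfl) j.1
    simpa only [y, dif_pos j.2] using this
  have hcard := Fintype.card_le_of_injective _ hinj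
  have hP : Fintype.card P = Z.acyclicCount L d r := by
    simp only [P, Fintype.card_sigma, Fintype.card_subtype, acyclicCount]
  rw [Fintype.card_fun, Fintype.card_fun, Fintype.card_fun, Fintype.card_bool, Fintype.card_fin,
    Fintype.card_fin, hP, ← pow_mul, mul_comm] at hcard
  exact (Nat.pow_le_pow_iff_right one_lt_two).1 hcard

theorem acyclicCount_div_le_deliveryTime (Z : Placement Λ N) {L : Fin Λ → ℕ} {d : User L → Fin N}
    (hd : Function.Injective d) (r : Fin Λ → ℕ) :
    (Z.acyclicCount L d r : ℝ) / Fintype.card Z.Idx ≤ Z.deliveryTime L d := by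
  have hF : (0 : ℝ) < Fintype.card Z.Idx := by exact_mod_cast Fintype.card_pos
  obtain ⟨m, hm⟩ := Z.exists_deliverable L d
  refine le_csInf ⟨_, 1, m, one_pos, hm, rfl⟩ ?_
  rintro _ ⟨b, m, hb, h, rfl⟩
  have hb' : (0 : ℝ) < b := by exact_mod_cast hb
  rw [div_le_div_iff₀ hF (by positivity)]
  have : (Z.acyclicCount L d r : ℝ) * b ≤ m := by exact_mod_cast h.acyclicCount_mul_le hd r
  nlinarith

end Placement

/-! ### Weights on sets of caches and the greedy order -/

section Weights

variable {Λ : ℕ} {X : Type*} [Fintype X]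

/-- The total weight of the elements whose set of caches is contained in `B`. -/
def weightWithin (s : X → Finset (Fin Λ)) (w : X → ℝ) (B : Finset (Fin Λ)) : ℝ :=
  ∑ x with s x ⊆ B, w x

/-- Double counting: an `x` with `s x ⊆ A` survives the removal of `k` exactly for the `A.card - t`
elements `k` of `A \ s x`. -/
theorem sum_weightWithin_erase {s : X → Finset (Fin Λ)} {t : ℕ} (hs : ∀ x, (s x).card = t)
    (w : X → ℝ) (A : Finset (Fin Λ)) :
    ∑ k ∈ A, weightWithin s w (A.erase k) = ((A.card : ℝ) - t) * weightWithin s w A := by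
  classical
  simp only [weightWithin, Finset.sum_filter]
  rw [Finset.sum_comm, Finset.mul_sum]
  refine Finset.sum_congr rfl fun x _ => ?_
  by_cases hx : s x ⊆ A
  · rw [if_pos hx, ← Finset.sum_filter, Finset.sum_const]
    have : A.filter (fun k => s x ⊆ A.erase k) = A \ s x := by
      ext k
      simp only [Finset.mem_filter, Finset.mem_sdiff, Finset.subset_erase, hx, true_and]
    rw [this, nsmul_eq_mul, Finset.cast_card_sdiff hx, hs]
  · rw [if_neg hx, mul_zero]
    refine Finset.sum_eq_zero fun k _ => if_neg fun h => hx (h.trans (Finset.erase_subset _ _))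

/-- The elementary symmetric function of the entries of `L` at the places in `A`. -/
def esymmOn (L : Fin Λ → ℕ) (t : ℕ) (A : Finset (Fin Λ)) : ℝ :=
  ∑ q ∈ A.powersetCard t, ((∏ i ∈ q, L i : ℕ) : ℝ)

theorem esymmOn_univ (L : Fin Λ → ℕ) (t : ℕ) : esymmOn L t Finset.univ = esymm L t := by
  simp only [esymmOn, esymm, Finset.esymm_map_val]
  push_cast
  rfl

theorem esymmOn_nonneg (L : Fin Λ → ℕ) (t : ℕ) (A : Finset (Fin Λ)) : 0 ≤ esymmOn L t A :=
  Finset.sum_nonneg fun _ _ => Nat.cast_nonneg _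

theorem esymmOn_pos {L : Fin Λ → ℕ} (hL : ∀ i, 0 < L i) {t : ℕ} {A : Finset (Fin Λ)}
    (hA : t ≤ A.card) : 0 < esymmOn L t A :=
  Finset.sum_pos (fun _ _ => Nat.cast_pos.2 (Finset.prod_pos fun i _ => hL i))
    (Finset.powersetCard_nonempty.2 hA)

theorem esymmOn_succ {L : Fin Λ → ℕ} (t : ℕ) {A : Finset (Fin Λ)} {k : Fin Λ} (hk : k ∈ A) :
    esymmOn L (t + 1) A = L k * esymmOn L t (A.erase k) + esymmOn L (t + 1) (A.erase k) := by
  have hk' := Finset.notMem_erase k A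
  have hdisj : Disjoint ((A.erase k).powersetCard (t + 1))
      (((A.erase k).powersetCard t).image (insert k)) := by
    rw [Finset.disjoint_left]
    intro q hq hq'
    obtain ⟨q', -, rfl⟩ := Finset.mem_image.1 hq'
    exact hk' ((Finset.mem_powersetCard.1 hq).1 (Finset.mem_insert_self _ _))
  have hmem : ∀ q ∈ (A.erase k).powersetCard t, k ∉ q := fun q hq h =>
    hk' ((Finset.mem_powersetCard.1 hq).1 h)
  conv_lhs => rw [esymmOn, ← Finset.insert_erase hk, Finset.powersetCard_succ_insert hk',
    Finset.sum_union hdisj]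
  rw [add_comm, Finset.sum_image, esymmOn, Finset.mul_sum]
  · congr 1
    refine Finset.sum_congr rfl fun q hq => ?_
    rw [Finset.prod_insert (hmem q hq), Nat.cast_mul]
  · intro q hq q' hq' h
    rw [← Finset.erase_insert (hmem q hq), ← Finset.erase_insert (hmem q' hq'), h]

theorem sum_esymmOn_erase (L : Fin Λ → ℕ) (t : ℕ) (A : Finset (Fin Λ)) :
    ∑ k ∈ A, esymmOn L t (A.erase k) = ((A.card : ℝ) - t) * esymmOn L t A := by
  have h : ∀ B, esymmOn L t B =
      weightWithin (X := {q : Finset (Fin Λ) // q.card = t}) Subtype.val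
        (fun q => ((∏ i ∈ q.1, L i : ℕ) : ℝ)) B := by
    intro B
    rw [esymmOn, weightWithin]
    refine (Finset.sum_bij (fun q _ => q.1) ?_ ?_ ?_ ?_).symm
    · intro q hq
      exact Finset.mem_powersetCard.2 ⟨(Finset.mem_filter.1 hq).2, q.2⟩
    · intro q _ q' _ h
      exact Subtype.ext h
    · intro q hq
      obtain ⟨h1, h2⟩ := Finset.mem_powersetCard.1 hq
      exact ⟨⟨q, h2⟩, by simpa using h1, rfl⟩
    · intros
      rfl
  simp only [h]
  exact sum_weightWithin_erase (fun q => q.2) _ _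

/-- For every nonnegative weight on sets of `t` caches, some order of the caches makes the acyclic
bound at least as large as for the weight proportional to `∏ i ∈ q, L i`. -/
theorem exists_order_le {L : Fin Λ → ℕ} (hL : ∀ i, 0 < L i) {s : X → Finset (Fin Λ)} {t : ℕ}
    (hs : ∀ x, (s x).card = t) {w : X → ℝ} (hw : ∀ x, 0 ≤ w x) (A : Finset (Fin Λ)) :
    ∃ r : Fin Λ → ℕ, esymmOn L (t + 1) A * weightWithin s w A ≤
      esymmOn L t A * ∑ i ∈ A, L i * weightWithin s w (A.filter fun c => r i < r c) := by
  classical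
  have hnn : ∀ B, 0 ≤ weightWithin s w B := fun B => Finset.sum_nonneg fun x _ => hw x
  induction hn : A.card generalizing A with
  | zero =>
    rw [Finset.card_eq_zero] at hn
    subst hn
    refine ⟨fun _ => 0, ?_⟩
    rw [esymmOn, Finset.powersetCard_eq_empty.2 (by simp)]
    simp
  | succ n ih =>
    rcases le_or_gt A.card t with hAt | hAt
    · refine ⟨fun _ => 0, ?_⟩
      rw [esymmOn, Finset.powersetCard_eq_empty.2 (by omega), Finset.sum_empty, zero_mul]
      exact mul_nonneg (esymmOn_nonneg _ _ _) (Finset.sum_nonneg fun i _ =>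
        mul_nonneg (Nat.cast_nonneg _) (hnn _))
    -- Removing `k` should retain at least as large a fraction of the weight as of `e_t`. Both
    -- fractions sum to `A.card - t` over `k ∈ A`, so such a `k` exists.
    · obtain ⟨k, hk, hchoice⟩ : ∃ k ∈ A, esymmOn L t (A.erase k) * weightWithin s w A ≤
          weightWithin s w (A.erase k) * esymmOn L t A := by
        refine Finset.exists_le_of_sum_le (Finset.card_pos.1 (by omega)) (le_of_eq ?_)
        rw [← Finset.sum_mul, ← Finset.sum_mul, sum_esymmOn_erase, sum_weightWithin_erase hs]
        ring
      have hcard := Finset.card_erase_of_mem hk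
      obtain ⟨r, hr⟩ := ih (A.erase k) (by omega)
      have hpos : 0 < esymmOn L t (A.erase k) := esymmOn_pos hL (by omega)
      -- The cache `k` goes first; the order on the rest is shifted by one.
      refine ⟨fun c => if c = k then 0 else r c + 1, ?_⟩
      rw [← Finset.add_sum_erase _ _ hk, esymmOn_succ t hk]
      have h1 : A.filter (fun c => (if k = k then 0 else r k + 1) <
          (if c = k then 0 else r c + 1)) = A.erase k := by
        ext c
        by_cases hc : c = k <;> simp [hc]
      have h2 : ∀ i ∈ A.erase k, A.filter (fun c => (if i = k then 0 else r i + 1) <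
          (if c = k then 0 else r c + 1)) = (A.erase k).filter fun c => r i < r c := by
        intro i hi
        ext c
        by_cases hc : c = k <;> simp [hc, Finset.ne_of_mem_erase hi]
      rw [h1, Finset.sum_congr rfl fun i hi => by rw [h2 i hi]]
      set V := ∑ i ∈ A.erase k, (L i : ℝ) *
        weightWithin s w ((A.erase k).filter fun c => r i < r c)
      have hLk : (0 : ℝ) ≤ L k := Nat.cast_nonneg _
      have h3 : esymmOn L (t + 1) (A.erase k) * weightWithin s w A ≤ esymmOn L t A * V := by
        refine le_of_mul_le_mul_right ?_ hpos
        have h4 := mul_le_mul_of_nonneg_left hchoice (esymmOn_nonneg L (t + 1) (A.erase k))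
        have h5 := mul_le_mul_of_nonneg_left hr (esymmOn_nonneg L t A)
        linarith
      have h6 := mul_le_mul_of_nonneg_left hchoice hLk
      linarith

end Weights


/-! ### The designed placement: acyclic bound and coded delivery -/

section Designed

variable {Λ N t : ℕ} {ht : t ≤ Λ} {Lbar : Fin Λ → ℕ} {hLbar : ∀ i, 0 < Lbar i}

variable (t Lbar) in
/-- The indices of the subfiles of the placement designed for `Lbar`. -/
abbrev SubfileIndex : Type := Σ τ : {τ : Finset (Fin Λ) // τ.card = t}, Fin (∏ i ∈ τ.1, Lbar i)

theorem card_filter_subfileIndex_subset (B : Finset (Fin Λ)) :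
    (Finset.univ.filter fun j : SubfileIndex t Lbar => j.1.1 ⊆ B).card =
      ∑ q ∈ B.powersetCard t, ∏ i ∈ q, Lbar i := by
  have h : Finset.univ.filter (fun j : SubfileIndex t Lbar => j.1.1 ⊆ B) =
      (Finset.univ.filter fun τ : {τ : Finset (Fin Λ) // τ.card = t} => τ.1 ⊆ B).sigma
        fun _ => Finset.univ := by
    ext j
    simp
  rw [h, Finset.card_sigma]
  simp only [Finset.card_univ, Fintype.card_fin]
  refine Finset.sum_bij (fun q _ => q.1) ?_ ?_ ?_ ?_
  · intro q hq
    exact Finset.mem_powersetCard.2 ⟨(Finset.mem_filter.1 hq).2, q.2⟩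
  · intro q _ q' _ h
    exact Subtype.ext h
  · intro q hq
    obtain ⟨h1, h2⟩ := Finset.mem_powersetCard.1 hq
    exact ⟨⟨q, h2⟩, by simpa using h1, rfl⟩
  · intros
    rfl

theorem card_subfileIndex : Fintype.card (SubfileIndex t Lbar) = esymm Lbar t := by
  rw [esymm, Finset.esymm_map_val, ← card_filter_subfileIndex_subset]
  simp

theorem card_idx_designedPlacement :
    Fintype.card (designedPlacement N t ht Lbar hLbar).Idx = esymm Lbar t :=
  card_subfileIndex

theorem esymm_pos (ht : t ≤ Λ) (hLbar : ∀ i, 0 < Lbar i) : 0 < esymm Lbar t := by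
  rw [← card_idx_designedPlacement (N := 0) (ht := ht) (hLbar := hLbar)]
  exact Fintype.card_pos

theorem acyclicCount_designedPlacement (L : Fin Λ → ℕ) (d : User L → Fin N) (r : Fin Λ → ℕ) :
    (designedPlacement N t ht Lbar hLbar).acyclicCount L d r =
      ∑ i, L i * ∑ q ∈ (Finset.univ.filter fun c => r i < r c).powersetCard t,
        ∏ c ∈ q, Lbar c := by
  have h : (designedPlacement N t ht Lbar hLbar).acyclicCount L d r = ∑ u : User L,
      (Finset.univ.filter fun j : SubfileIndex t Lbar => ∀ c ∈ j.1.1, r u.1 < r c).card := rfl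
  rw [h, Fintype.sum_sigma]
  refine Finset.sum_congr rfl fun i _ => ?_
  have hi : Finset.univ.filter (fun j : SubfileIndex t Lbar => ∀ c ∈ j.1.1, r i < r c) =
      Finset.univ.filter fun j : SubfileIndex t Lbar =>
        j.1.1 ⊆ Finset.univ.filter fun c => r i < r c := by
    ext j
    simp [Finset.subset_iff]
  simp only [hi, card_filter_subfileIndex_subset, Finset.sum_const, Finset.card_univ,
    Fintype.card_fin, smul_eq_mul]

theorem permutationValue_eq_div (Lbar L : Fin Λ → ℕ) (σ : Fin (Λ - t) ↪ Fin Λ) :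
    permutationValue t Lbar L σ = ((∑ k : Fin (Λ - t), L (σ k) *
      ∑ q ∈ Finset.powersetCard t (Finset.univ \ (Finset.Iic k).map σ),
        ∏ i ∈ q, Lbar i : ℕ) : ℝ) / esymm Lbar t := by
  rw [permutationValue]
  push_cast
  simp only [Finset.sum_div, mul_div_assoc]

theorem permutationValue_le_deliveryTime {L : Fin Λ → ℕ} {d : User L → Fin N}
    (hd : Function.Injective d) (σ : Fin (Λ - t) ↪ Fin Λ) :
    permutationValue t Lbar L σ ≤ (designedPlacement N t ht Lbar hLbar).deliveryTime L d := by
  classical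
  -- Caches outside the range of `σ` get the value `Λ`, beyond every position of `σ`; their own
  -- terms in the count are dropped at the end.
  let r : Fin Λ → ℕ := Function.extend σ (fun k => (k : ℕ)) fun _ => Λ
  refine le_trans ?_ (Placement.acyclicCount_div_le_deliveryTime _ hd r)
  rw [permutationValue_eq_div, card_idx_designedPlacement]
  refine div_le_div_of_nonneg_right (Nat.cast_le.2 ?_) (Nat.cast_nonneg _)
  rw [acyclicCount_designedPlacement]
  have h : ∀ k : Fin (Λ - t), (Finset.univ.filter fun c => r (σ k) < r c) =
      Finset.univ \ (Finset.Iic k).map σ := by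
    intro k
    ext c
    simp only [Finset.mem_filter, Finset.mem_univ, true_and, Finset.mem_sdiff, Finset.mem_map,
      Finset.mem_Iic, not_exists, not_and, r, σ.injective.extend_apply]
    by_cases hc : ∃ k', σ k' = c
    · obtain ⟨k', rfl⟩ := hc
      rw [σ.injective.extend_apply]
      constructor
      · intro h k'' hk'' he
        rw [σ.injective he] at hk''
        exact absurd h (not_lt.2 hk'')
      · intro h
        by_contra hlt
        exact h k' (not_lt.1 hlt) rfl
    · rw [Function.extend_apply' _ _ _ hc]
      exact ⟨fun _ k' _ he => hc ⟨k', he⟩, fun _ => by omega⟩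
  simp only [← h]
  rw [← Finset.sum_map Finset.univ σ fun i =>
    L i * ∑ q ∈ (Finset.univ.filter fun c => r i < r c).powersetCard t, ∏ c ∈ q, Lbar c]
  exact Finset.sum_le_sum_of_subset (Finset.subset_univ _)

/-- The number of transmissions of the coded delivery scheme for the set `S` of caches. -/
def multicastLength (Lbar L : Fin Λ → ℕ) (S : Finset (Fin Λ)) : ℕ :=
  S.sup fun i => L i * ∏ c ∈ S.erase i, Lbar c

/-- The summand of slot `k` of a multicast that serves the users at cache `i` with the subfiles
of `τ`. -/
def packet (L : Fin Λ → ℕ) (d : User L → Fin N)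
    (W : Fin N → SubfileIndex t Lbar → Fin 1 → Bool) (i : Fin Λ)
    (τ : {τ : Finset (Fin Λ) // τ.card = t}) (k : ℕ) : ZMod 2 :=
  if h : k < L i * ∏ c ∈ τ.1, Lbar c then
    if W (d ⟨i, (finProdFinEquiv.symm ⟨k, h⟩).1⟩) ⟨τ, (finProdFinEquiv.symm ⟨k, h⟩).2⟩ 0 then 1
    else 0
  else 0

/-- Slot `k` of the multicast to the set `S` of caches: the sum of the packets of the users at the
caches `i ∈ S`, taken from the subfiles of `S \ {i}`. -/
def multicast (L : Fin Λ → ℕ) (d : User L → Fin N)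
    (W : Fin N → SubfileIndex t Lbar → Fin 1 → Bool) (S : Finset (Fin Λ)) (k : ℕ) : ZMod 2 :=
  ∑ p : Fin Λ × {τ : Finset (Fin Λ) // τ.card = t} with p.1 ∉ p.2.1 ∧ insert p.1 p.2.1 = S,
    packet L d W p.1 p.2 k

/-- The multicasts to `insert i τ` and the subfiles stored in cache `i` determine the subfiles of
`τ` requested by the users at cache `i`. -/
theorem eq_of_multicast_eq {L : Fin Λ → ℕ} {d : User L → Fin N} {i : Fin Λ} (l : Fin (L i))
    {W W' : Fin N → SubfileIndex t Lbar → Fin 1 → Bool}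
    (hstored : ∀ n (j : SubfileIndex t Lbar), i ∈ j.1.1 → W n j = W' n j)
    {τ : {τ : Finset (Fin Λ) // τ.card = t}} (m : Fin (∏ c ∈ τ.1, Lbar c)) (hi : i ∉ τ.1)
    (hmulti : ∀ k < multicastLength Lbar L (insert i τ.1),
      multicast L d W (insert i τ.1) k = multicast L d W' (insert i τ.1) k) :
    W (d ⟨i, l⟩) ⟨τ, m⟩ 0 = W' (d ⟨i, l⟩) ⟨τ, m⟩ 0 := by
  set s := finProdFinEquiv (l, m) with hs
  have hlt : (s : ℕ) < multicastLength Lbar L (insert i τ.1) := by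
    refine lt_of_lt_of_le s.2 ?_
    have := Finset.le_sup (f := fun c => L c * ∏ c ∈ (insert i τ.1).erase c, Lbar c)
      (Finset.mem_insert_self i τ.1)
    rw [Finset.erase_insert hi] at this
    exact this
  replace hmulti := hmulti s hlt
  have hp0 : (i, τ) ∈ Finset.univ.filter fun p : Fin Λ × {τ : Finset (Fin Λ) // τ.card = t} =>
      p.1 ∉ p.2.1 ∧ insert p.1 p.2.1 = insert i τ.1 := by simp [hi]
  rw [multicast, multicast, ← Finset.add_sum_erase _ _ hp0,
    ← Finset.add_sum_erase _ _ hp0] at hmulti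
  have hrest : ∀ p ∈ (Finset.univ.filter fun p : Fin Λ × {τ : Finset (Fin Λ) // τ.card = t} =>
      p.1 ∉ p.2.1 ∧ insert p.1 p.2.1 = insert i τ.1).erase (i, τ),
      packet L d W p.1 p.2 s = packet L d W' p.1 p.2 s := by
    -- Every other summand has `i' ≠ i` and so `i ∈ τ'`: its subfiles are in cache `i`, and it
    -- cancels.
    rintro ⟨i', τ'⟩ hp
    obtain ⟨hne, hp⟩ := Finset.mem_erase.1 hp
    obtain ⟨-, hi', hS⟩ := Finset.mem_filter.1 hp
    have hii : i ≠ i' := by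
      rintro rfl
      refine hne (Prod.ext rfl (Subtype.ext ?_))
      rw [← Finset.erase_insert hi', hS, Finset.erase_insert hi]
    have hiτ : i ∈ τ'.1 := by
      have : i ∈ insert i' τ'.1 := hS ▸ Finset.mem_insert_self i τ.1
      exact Finset.mem_of_mem_insert_of_ne this hii
    simp only [packet]
    split_ifs with h
    all_goals simp_all
  rw [Finset.sum_congr rfl hrest, add_left_inj] at hmulti
  have hfin : ∀ h : (s : ℕ) < L i * ∏ c ∈ τ.1, Lbar c, finProdFinEquiv.symm ⟨s, h⟩ = (l, m) :=
    fun h => by rw [Fin.eta, hs, Equiv.symm_apply_apply]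
  simp only [packet, dif_pos s.2, hfin] at hmulti
  have h2 : ∀ x y : Bool, (if x then (1 : ZMod 2) else 0) = (if y then 1 else 0) → x = y := by
    decide
  exact h2 _ _ hmulti

theorem deliverable_designedPlacement (L : Fin Λ → ℕ) (d : User L → Fin N) :
    (designedPlacement N t ht Lbar hLbar).Deliverable L d 1
      (∑ S ∈ Finset.powersetCard (t + 1) Finset.univ, multicastLength Lbar L S) := by
  classical
  refine Placement.deliverable_of_determines _
    (M := Σ S : (Finset.powersetCard (t + 1) (Finset.univ : Finset (Fin Λ)) :),
      Fin (multicastLength Lbar L S.1)) ?_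
    (fun W p => decide (multicast L d W p.1.1 p.2 = 0)) ?_
  · rw [Fintype.card_sigma]
    simp only [Fintype.card_fin]
    exact Finset.sum_coe_sort _ _
  rintro ⟨i, l⟩ W W' henc hcache
  have hstored : ∀ n (j : SubfileIndex t Lbar), i ∈ j.1.1 → W n j = W' n j :=
    fun n j hj => congrFun (congrFun hcache n) ⟨j, hj⟩
  refine funext fun j => funext fun z => ?_
  rw [Subsingleton.elim z 0]
  by_cases hi : i ∈ j.1.1
  · exact congrFun (hstored _ j hi) 0
  have hSmem : insert i j.1.1 ∈ Finset.powersetCard (t + 1) (Finset.univ : Finset (Fin Λ)) :=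
    Finset.mem_powersetCard.2
      ⟨Finset.subset_univ _, by rw [Finset.card_insert_of_notMem hi, j.1.2]⟩
  refine eq_of_multicast_eq l hstored j.2 hi fun k hk => ?_
  have h : ∀ x y : ZMod 2, decide (x = 0) = decide (y = 0) → x = y := by decide
  exact h _ _ (congrFun henc ⟨⟨insert i j.1.1, hSmem⟩, ⟨k, hk⟩⟩)

theorem worstCaseTime_designedPlacement_le {L : Fin Λ → ℕ} [Nonempty (User L → Fin N)] :
    (designedPlacement N t ht Lbar hLbar).worstCaseTime L ≤
      ((∑ S ∈ Finset.powersetCard (t + 1) Finset.univ, multicastLength Lbar L S : ℕ) : ℝ) /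
        esymm Lbar t := by
  refine ciSup_le fun d => ?_
  rw [← card_idx_designedPlacement (N := N) (ht := ht) (hLbar := hLbar)]
  exact Placement.deliveryTime_le _ (deliverable_designedPlacement L d)

/-- Ordering the caches by decreasing ratio `L i / Lbar i` realizes the length of the scheme. -/
theorem exists_sum_multicastLength_le (hLbar : ∀ i, 0 < Lbar i) (L : Fin Λ → ℕ) :
    ∃ σ : Fin (Λ - t) ↪ Fin Λ,
      ∑ S ∈ Finset.powersetCard (t + 1) Finset.univ, multicastLength Lbar L S ≤
        ∑ k : Fin (Λ - t), L (σ k) *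
          ∑ q ∈ Finset.powersetCard t (Finset.univ \ (Finset.Iic k).map σ), ∏ i ∈ q, Lbar i := by
  classical
  rcases Nat.eq_zero_or_pos (Λ - t) with h0 | hpos
  · refine ⟨Fin.castLEEmb (Nat.sub_le Λ t), ?_⟩
    rw [Finset.powersetCard_eq_empty.2 (by rw [Finset.card_univ, Fintype.card_fin]; omega)]
    exact Nat.zero_le _
  have : Nonempty (Fin (Λ - t)) := ⟨⟨0, hpos⟩⟩
  -- The sign makes the increasing sort an order by decreasing ratio.
  let f : Fin Λ → ℚ := fun i => -((L i : ℚ) / Lbar i)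
  let π : Equiv.Perm (Fin Λ) := Tuple.sort f
  have hmono : Monotone (f ∘ π) := Tuple.monotone_sort f
  let σ : Fin (Λ - t) ↪ Fin Λ := (Fin.castLEEmb (Nat.sub_le Λ t)).trans π.toEmbedding
  have hσ : ∀ k, σ k = π (Fin.castLE (Nat.sub_le Λ t) k) := fun k => rfl
  refine ⟨σ, ?_⟩
  have key : ∀ S ∈ Finset.powersetCard (t + 1) (Finset.univ : Finset (Fin Λ)),
      ∃ k : Fin (Λ - t), σ k ∈ S ∧ (∀ c ∈ S, π.symm (σ k) ≤ π.symm c) := by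
    intro S hS
    have hcard := (Finset.mem_powersetCard.1 hS).2
    -- The other `t` elements of `S` come after its first one, whose position is therefore below `Λ
    -- - t`, in the domain of `σ`.
    obtain ⟨i, hi, hmin⟩ := S.exists_min_image π.symm (Finset.card_pos.1 (by omega))
    have hle : S.card ≤ (Finset.Ici (π.symm i)).card := by
      rw [← Finset.card_map π.symm.toEmbedding]
      refine Finset.card_le_card fun c hc => ?_
      obtain ⟨c', hc', rfl⟩ := Finset.mem_map.1 hc
      exact Finset.mem_Ici.2 (hmin c' hc')
    rw [Fin.card_Ici, hcard] at hle
    have hk : (π.symm i : ℕ) < Λ - t := by omega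
    have hσi : σ ⟨π.symm i, hk⟩ = i := by
      rw [hσ]
      exact π.apply_symm_apply i
    exact ⟨⟨π.symm i, hk⟩, hσi.symm ▸ hi, hσi.symm ▸ hmin⟩
  choose! κ hκS hκmin using key
  simp only [Finset.mul_sum]
  rw [Finset.sum_sigma' Finset.univ (fun k : Fin (Λ - t) =>
      Finset.powersetCard t (Finset.univ \ (Finset.Iic k).map σ))
      (fun k q => L (σ k) * ∏ i ∈ q, Lbar i)]
  have hmaps : ∀ S ∈ Finset.powersetCard (t + 1) (Finset.univ : Finset (Fin Λ)),
      (⟨κ S, S.erase (σ (κ S))⟩ : Σ _ : Fin (Λ - t), Finset (Fin Λ)) ∈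
        (Finset.univ : Finset (Fin (Λ - t))).sigma fun k =>
          Finset.powersetCard t (Finset.univ \ (Finset.Iic k).map σ) := by
    intro S hS
    refine Finset.mem_sigma.2 ⟨Finset.mem_univ _, Finset.mem_powersetCard.2 ⟨?_, ?_⟩⟩
    · intro c hc
      obtain ⟨hne, hc⟩ := Finset.mem_erase.1 hc
      refine Finset.mem_sdiff.2 ⟨Finset.mem_univ _, fun h => ?_⟩
      obtain ⟨k, hk, rfl⟩ := Finset.mem_map.1 h
      have h1 := hκmin S hS _ hc
      rw [hσ, hσ, Equiv.symm_apply_apply, Equiv.symm_apply_apply, Fin.castLE_le_castLE_iff] at h1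
      exact hne (by rw [le_antisymm h1 (Finset.mem_Iic.1 hk)])
    · rw [Finset.card_erase_of_mem (hκS S hS), (Finset.mem_powersetCard.1 hS).2]
      rfl
  have hle : ∀ S ∈ Finset.powersetCard (t + 1) (Finset.univ : Finset (Fin Λ)),
      multicastLength Lbar L S ≤ L (σ (κ S)) * ∏ i ∈ S.erase (σ (κ S)), Lbar i := by
    intro S hS
    refine Finset.sup_le fun i hi => ?_
    have h1 := hmono (hκmin S hS i hi)
    simp only [Function.comp_apply, Equiv.apply_symm_apply, f, neg_le_neg_iff] at h1
    have hp : ∀ j, (0 : ℚ) < Lbar j := fun j => Nat.cast_pos.2 (hLbar j)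
    rw [div_le_div_iff₀ (hp _) (hp _)] at h1
    have h2 : L i * Lbar (σ (κ S)) ≤ L (σ (κ S)) * Lbar i := by exact_mod_cast h1
    -- Multiplying by both factors `Lbar` completes each product to the one over `S`, leaving the
    -- comparison of ratios.
    refine le_of_mul_le_mul_right ?_ (Nat.mul_pos (hLbar i) (hLbar (σ (κ S))))
    have e1 := Finset.mul_prod_erase S Lbar hi
    have e2 := Finset.mul_prod_erase S Lbar (hκS S hS)
    calc L i * (∏ c ∈ S.erase i, Lbar c) * (Lbar i * Lbar (σ (κ S)))
        = L i * Lbar (σ (κ S)) * (Lbar i * ∏ c ∈ S.erase i, Lbar c) := by ring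
      _ ≤ L (σ (κ S)) * Lbar i * (Lbar i * ∏ c ∈ S.erase i, Lbar c) :=
          Nat.mul_le_mul_right _ h2
      _ = L (σ (κ S)) * Lbar i * (Lbar (σ (κ S)) * ∏ c ∈ S.erase (σ (κ S)), Lbar c) := by
          rw [e1, e2]
      _ = _ := by ring
  have hinj : Set.InjOn (fun S => (⟨κ S, S.erase (σ (κ S))⟩ : Σ _ : Fin (Λ - t), Finset (Fin Λ)))
      (Finset.powersetCard (t + 1) (Finset.univ : Finset (Fin Λ))) := by
    intro S hS S' hS' h
    simp only [Sigma.mk.injEq, heq_eq_eq] at h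
    rw [← Finset.insert_erase (hκS S hS), ← Finset.insert_erase (hκS S' hS'), h.2, h.1]
  calc ∑ S ∈ Finset.powersetCard (t + 1) Finset.univ, multicastLength Lbar L S
      ≤ ∑ S ∈ Finset.powersetCard (t + 1) Finset.univ,
          L (σ (κ S)) * ∏ i ∈ S.erase (σ (κ S)), Lbar i := Finset.sum_le_sum hle
    _ = ∑ x ∈ (Finset.powersetCard (t + 1) Finset.univ).image
          (fun S => (⟨κ S, S.erase (σ (κ S))⟩ : Σ _ : Fin (Λ - t), Finset (Fin Λ))),
          L (σ x.1) * ∏ i ∈ x.2, Lbar i := 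
          (Finset.sum_image (f := fun x : Σ _ : Fin (Λ - t), Finset (Fin Λ) =>
            L (σ x.1) * ∏ i ∈ x.2, Lbar i) hinj).symm
    _ ≤ _ := Finset.sum_le_sum_of_subset (Finset.image_subset_iff.2 hmaps)

/-- With a correct estimate all lists in a multicast are equally long, so nothing is padded. -/
theorem multicastLength_self {S : Finset (Fin Λ)} (hS : S.Nonempty) (L : Fin Λ → ℕ) :
    multicastLength L L S = ∏ i ∈ S, L i := by
  rw [multicastLength, Finset.sup_congr rfl fun i hi => Finset.mul_prod_erase S L hi,
    Finset.sup_const hS]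

end Designed

/-! ### The lower bound for all regular placements -/

theorem exists_injective_demand {Λ N : ℕ} {L : Fin Λ → ℕ} (hN : ∑ i, L i ≤ N) :
    ∃ d : User L → Fin N, Function.Injective d := by
  obtain ⟨e⟩ := Function.Embedding.nonempty_of_card_le (α := User L) (β := Fin N) (by simpa)
  exact ⟨e, e.injective⟩

/-- Averaged over the cyclic shifts of an injective demand vector, the acyclic count only depends
on how the subfiles of the whole library are stored. -/
theorem sum_acyclicCount_shift {Λ N : ℕ} [NeZero N] (Z : Placement Λ N) (L : Fin Λ → ℕ)
    (d : User L → Fin N) (r : Fin Λ → ℕ) :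
    ((∑ s : Fin N, Z.acyclicCount L (fun u => d u + s) r : ℕ) : ℝ) =
      ∑ i, L i * weightWithin (fun x : Fin N × Z.Idx => Z.stored x.1 x.2) (fun _ => 1)
        (Finset.univ.filter fun c => r i < r c) := by
  classical
  have h : ∀ i : Fin Λ, weightWithin (fun x : Fin N × Z.Idx => Z.stored x.1 x.2) (fun _ => 1)
      (Finset.univ.filter fun c => r i < r c) =
      ∑ n, ((Finset.univ.filter fun j : Z.Idx => ∀ c ∈ Z.stored n j, r i < r c).card : ℝ) := by
    intro i
    rw [weightWithin, Finset.sum_filter, Fintype.sum_prod_type]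
    refine Finset.sum_congr rfl fun n _ => ?_
    rw [← Finset.sum_filter, Finset.sum_const, nsmul_eq_mul, mul_one]
    congr 2
    ext j
    simp [Finset.subset_iff]
  simp only [Placement.acyclicCount]
  rw [Finset.sum_comm, Fintype.sum_sigma]
  push_cast
  refine Finset.sum_congr rfl fun i _ => ?_
  rw [h]
  refine (Finset.sum_congr rfl fun l _ => ?_).trans
    (by rw [Finset.sum_const, Finset.card_univ, Fintype.card_fin, nsmul_eq_mul])
  -- As `s` varies, the file `d u + s` runs once through the library.
  exact Equiv.sum_comp (Equiv.addLeft (d ⟨i, l⟩))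
    fun n => ((Finset.univ.filter fun j : Z.Idx => ∀ c ∈ Z.stored n j, r i < r c).card : ℝ)

/-- No regular placement beats `e_{t+1}(L) / e_t(L)`. -/
theorem esymm_div_le_worstCaseTime {Λ N t : ℕ} (ht : t ≤ Λ) {L : Fin Λ → ℕ} (hL : ∀ i, 0 < L i)
    (hN : ∑ i, L i ≤ N) (Z : Placement Λ N) (hZ : Z.IsRegular t) :
    (esymm L (t + 1) : ℝ) / esymm L t ≤ Z.worstCaseTime L := by
  classical
  obtain ⟨d, hd⟩ := exists_injective_demand hN
  have hF : (0 : ℝ) < Fintype.card Z.Idx := by exact_mod_cast Fintype.card_pos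
  have het : (0 : ℝ) < esymm L t := by exact_mod_cast esymm_pos ht hL
  -- Cyclic shifts need `N > 0`; if `N = 0`, positivity of `L` leaves no caches and the bound is
  -- zero.
  rcases Nat.eq_zero_or_pos N with hN0 | hN0
  · have hΛ : Λ = 0 := by
      by_contra h
      have := Finset.single_le_sum (f := L) (fun _ _ => Nat.zero_le _)
        (Finset.mem_univ (⟨0, Nat.pos_of_ne_zero h⟩ : Fin Λ))
      have := hL ⟨0, Nat.pos_of_ne_zero h⟩
      omega
    subst hΛ
    have h0 : esymm L (t + 1) = 0 := by
      rw [esymm, Finset.esymm_map_val, Finset.powersetCard_eq_empty.2 (by simp), Finset.sum_empty]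
    rw [h0, Nat.cast_zero, zero_div]
    refine le_trans ?_ (Z.deliveryTime_le_worstCaseTime d)
    refine Real.sInf_nonneg ?_
    rintro _ ⟨b, m, -, -, rfl⟩
    positivity
  have : NeZero N := ⟨hN0.ne'⟩
  have hNpos : (0 : ℝ) < N := by exact_mod_cast hN0
  obtain ⟨r, hr⟩ := exists_order_le hL (X := Fin N × Z.Idx)
    (s := fun x => Z.stored x.1 x.2) (fun x => hZ x.1 x.2) (w := fun _ => 1)
    (fun _ => zero_le_one) Finset.univ
  have hw : weightWithin (fun x : Fin N × Z.Idx => Z.stored x.1 x.2) (fun _ => 1) Finset.univ =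
      N * Fintype.card Z.Idx := by
    simp [weightWithin]
  rw [← sum_acyclicCount_shift Z L d r, hw, esymmOn_univ, esymmOn_univ] at hr
  push_cast at hr
  -- Some shift does at least as well as the average.
  obtain ⟨s, -, hs⟩ : ∃ s ∈ (Finset.univ : Finset (Fin N)),
      (esymm L (t + 1) : ℝ) * Fintype.card Z.Idx ≤
        esymm L t * Z.acyclicCount L (fun u => d u + s) r := by
    refine Finset.exists_le_of_sum_le ⟨0, Finset.mem_univ _⟩ ?_
    rw [Finset.sum_const, Finset.card_univ, Fintype.card_fin, nsmul_eq_mul, ← Finset.mul_sum]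
    linarith
  refine le_trans ?_ (Z.deliveryTime_le_worstCaseTime fun u => d u + s)
  refine le_trans ?_ (Z.acyclicCount_div_le_deliveryTime
    (fun u v h => hd (add_right_cancel h)) r)
  rw [div_le_div_iff₀ het hF]
  linarith

end SharedCache

theorem theorem4 (Λ N t : ℕ) (ht : t ≤ Λ) (Lbar L : Fin Λ → ℕ) (hLbar : ∀ i, 0 < Lbar i)
    (hN : ∑ i, L i ≤ N) :
    IsGreatest (Set.range (SharedCache.permutationValue t Lbar L))
        ((SharedCache.designedPlacement N t ht Lbar hLbar).worstCaseTime L) ∧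
      (∑ i, Lbar i ≤ N →
        (SharedCache.designedPlacement N t ht Lbar hLbar).IsOptimalRegular t Lbar) := by
  open SharedCache in
  have hlower : ∀ σ, permutationValue t Lbar L σ ≤
      (designedPlacement N t ht Lbar hLbar).worstCaseTime L := by
    intro σ
    obtain ⟨d, hd⟩ := exists_injective_demand hN
    exact (permutationValue_le_deliveryTime hd σ).trans
      (Placement.deliveryTime_le_worstCaseTime _ d)
  open SharedCache in
  refine ⟨⟨?_, ?_⟩, fun hN' => ⟨fun n j => j.1.2, fun Z' hZ' => ?_⟩⟩
  · obtain ⟨d, -⟩ := exists_injective_demand hN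
    have : Nonempty (User L → Fin N) := ⟨d⟩
    obtain ⟨σ, hσ⟩ := exists_sum_multicastLength_le (t := t) hLbar L
    refine ⟨σ, le_antisymm (hlower σ) (worstCaseTime_designedPlacement_le.trans ?_)⟩
    rw [permutationValue_eq_div]
    exact div_le_div_of_nonneg_right (Nat.cast_le.2 hσ) (Nat.cast_nonneg _)
  · rintro _ ⟨σ, rfl⟩
    exact hlower σ
  · obtain ⟨d, -⟩ := exists_injective_demand hN'
    have : Nonempty (User Lbar → Fin N) := ⟨d⟩
    refine worstCaseTime_designedPlacement_le.trans
      (le_trans (le_of_eq ?_) (esymm_div_le_worstCaseTime ht hLbar hN' Z' hZ'))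
    rw [esymm, Finset.esymm_map_val]
    congr 2
    rw [esymm, Finset.esymm_map_val]
    refine Finset.sum_congr rfl fun S hS => multicastLength_self (Finset.card_pos.1 ?_) Lbar
    rw [(Finset.mem_powersetCard.1 hS).2]
    exact Nat.succ_pos t
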